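/- A partition with designated summands of weight $m$ is an integer partition of $m$ in which, for each part size that occurs, exactly one of the occurrences of that part is designated (marked). Let $PD_2(m)$ denote the number of partitions with designated summands of weight $m$ in which no part is divisible by $2$, i.e., all parts are odd. Then for all integers $\alpha \ge 0$ and $n \ge 0$, $$PD_2\bigl(2^\alpha(8n+7)\bigr) \equiv 0 \pmod{8}.$$ -/

import Mathlib

/-- The `k`-regular partitions of `n` with designated summands: a partition of `n` none of whose
parts is divisible by `k`, together with, for every part size `i` that occurs in it, a choice of
exactly one of the occurrences of `i` (an element of `Fin c`, where `c` is the multiplicity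
of `i`). -/
abbrev RegularDesignatedPartition (k n : ℕ) : Type :=
  Σ μ : {μ : n.Partition // ∀ i ∈ μ.parts, ¬ k ∣ i},
    (i : {i : ℕ // i ∈ μ.1.parts.toFinset}) → Fin (μ.1.parts.count i.1)

/-- `PD k n` is the number of `k`-regular partitions of `n` with designated summands. -/
def PD (k n : ℕ) : ℕ := Fintype.card (RegularDesignatedPartition k n)

/-! With `x = X ^ i`, an odd part `i` contributes `1 + x/(1-x)^2 = (1 - x + x^2)/(1-x)^2` to the
generating function. If `w^2 + w + 1 = 0`, then `(1 + w x)(w + x) = w (1 - x + x^2)`, while `w = -1`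
gives `-(1-x)^2`. Numerator and denominator are thus two Jacobi triple products, the Euler factor
cancels, and the series is `Θ / (1 + 2t)` with `Θ = ∑ w^k X^(k^2)` over all integers `k` and `t =
∑_{d ≥ 1} (-1)^d X^(d^2)`. Modulo 8, `(1 + 2t)^4 = 1`, so the inverse of `1 + 2t` is its cube `1 +
6t + 4t^2`; and `t^2 ≡ ∑ X^(2d^2)` mod 2. Hence only exponents `a^2 + b^2` and `a^2 + 2b^2` survive
(`cast_PD_two_eq_zero`), and descent on `α` shows that neither form represents `2^α (8n+7)`.
Infinite products are replaced by finite ones modulo a power of `X`. -/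

open PowerSeries Finset

/-! ### Gaussian binomials and the finite `q`-binomial theorem -/

section QBinomial

variable {S : Type*} [CommRing S]

/-- The Gaussian binomial coefficient `[m choose j]` evaluated at `q`. -/
def qBinom (q : S) : ℕ → ℕ → S
  | _, 0 => 1
  | 0, _ + 1 => 0
  | m + 1, j + 1 => qBinom q m j + q ^ (j + 1) * qBinom q m (j + 1)

/-- The `q`-Pochhammer symbol `(q; q)_m`. -/
def qPoch (q : S) (m : ℕ) : S := ∏ i ∈ range m, (1 - q ^ (i + 1))

lemma qPoch_succ (q : S) (m : ℕ) : qPoch q (m + 1) = qPoch q m * (1 - q ^ (m + 1)) :=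
  prod_range_succ _ _

lemma qBinom_zero_right (q : S) (m : ℕ) : qBinom q m 0 = 1 := by
  cases m <;> rfl

lemma qBinom_succ_succ (q : S) (m j : ℕ) :
    qBinom q (m + 1) (j + 1) = qBinom q m j + q ^ (j + 1) * qBinom q m (j + 1) := rfl

lemma qBinom_eq_zero_of_lt (q : S) {m j : ℕ} (h : m < j) : qBinom q m j = 0 := by
  induction m generalizing j with
  | zero => obtain ⟨j, rfl⟩ := Nat.exists_eq_add_one_of_ne_zero h.ne'; rfl
  | succ m ih =>
    obtain ⟨j, rfl⟩ := Nat.exists_eq_add_one_of_ne_zero (Nat.ne_zero_of_lt h)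
    rw [qBinom_succ_succ, ih (by omega), ih (by omega)]
    simp

lemma qBinom_self (q : S) (m : ℕ) : qBinom q m m = 1 := by
  induction m with
  | zero => rfl
  | succ m ih => rw [qBinom_succ_succ, ih, qBinom_eq_zero_of_lt q (Nat.lt_succ_self m)]; simp

lemma qBinom_mul_qPoch (q : S) (j k : ℕ) :
    qBinom q (j + k) j * qPoch q j * qPoch q k = qPoch q (j + k) := by
  obtain ⟨m, hm⟩ : ∃ m, m = j + k := ⟨_, rfl⟩
  induction m generalizing j k with
  | zero =>
    obtain ⟨rfl, rfl⟩ : j = 0 ∧ k = 0 := by omega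
    simp [qPoch, qBinom]
  | succ m ih =>
    rcases j with _ | j
    · simp [qBinom_zero_right, qPoch]
    rcases k with _ | k
    · simp [qBinom_self, qPoch]
    have h1 := ih j (k + 1) (by omega)
    have h2 := ih (j + 1) k (by omega)
    rw [show j + 1 + k = j + (k + 1) by ring] at h2
    rw [show j + 1 + (k + 1) = j + (k + 1) + 1 by ring, qBinom_succ_succ, qPoch_succ q (j + (k + 1))]
    rw [qPoch_succ] at h1 h2 ⊢
    rw [qPoch_succ q k]
    linear_combination (1 - q ^ (j + 1)) * h1 + q ^ (j + 1) * (1 - q ^ (k + 1)) * h2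

/-- The `q`-binomial theorem in homogeneous form. -/
lemma prod_add_mul_pow_eq_sum_qBinom (q a b : S) (m : ℕ) :
    ∏ i ∈ range m, (a + b * q ^ i) =
      ∑ p ∈ antidiagonal m, q ^ (p.1.choose 2) * qBinom q m p.1 * a ^ p.2 * b ^ p.1 := by
  induction m generalizing b with
  | zero => simp [qBinom]
  | succ m ih =>
    have key : ∑ p ∈ antidiagonal m,
          a * (q ^ (p.1.choose 2) * qBinom q m p.1 * a ^ p.2 * (b * q) ^ p.1) =
        a ^ (m + 1) + ∑ p ∈ antidiagonal m, q ^ ((p.1 + 1).choose 2) *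
          (q ^ (p.1 + 1) * qBinom q m (p.1 + 1)) * a ^ p.2 * b ^ (p.1 + 1) := by
      have h1 := Finset.Nat.sum_antidiagonal_succ (n := m) (f := fun p ↦
        q ^ (p.1.choose 2) * (q ^ p.1 * qBinom q m p.1) * a ^ p.2 * b ^ p.1)
      have h2 := Finset.Nat.sum_antidiagonal_succ' (n := m) (f := fun p ↦
        q ^ (p.1.choose 2) * (q ^ p.1 * qBinom q m p.1) * a ^ p.2 * b ^ p.1)
      rw [h1] at h2
      simp only [qBinom_eq_zero_of_lt q (Nat.lt_succ_self m), qBinom_zero_right] at h2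
      simp only [Nat.choose_zero_succ, pow_zero, mul_one, one_mul, mul_zero, zero_mul,
        zero_add] at h2
      rw [h2]
      refine sum_congr rfl fun p _ ↦ ?_
      ring
    have hshift : ∀ i, a + b * q ^ (i + 1) = a + b * q * q ^ i := fun i ↦ by ring
    rw [prod_range_succ']
    simp only [hshift, ih]
    rw [Finset.Nat.sum_antidiagonal_succ, pow_zero, mul_one, mul_add, mul_comm _ a, mul_sum, key]
    simp only [qBinom_succ_succ, qBinom_zero_right, Nat.choose_zero_succ, pow_zero, mul_one,
      one_mul]
    rw [add_assoc, sum_mul, ← sum_add_distrib]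
    congr 1
    refine sum_congr rfl fun p _ ↦ ?_
    have : (p.1 + 1).choose 2 = p.1 + p.1.choose 2 := by
      rw [Nat.choose_succ_succ' p.1 1, Nat.choose_one_right]
    rw [this]
    ring

end QBinomial

/-! ### Jacobi triple product, finite and truncated -/

section TripleProduct

variable {R : Type*} [CommRing R]

lemma two_mul_choose_two_add (j : ℕ) : 2 * j.choose 2 + j = j ^ 2 := by
  induction j with
  | zero => rfl
  | succ j ih => rw [Nat.choose_succ_succ' j 1, Nat.choose_one_right]; linarith

lemma sq_add_eq_natAbs_sq_add {n j k : ℕ} (h : j + k = 2 * n) :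
    j ^ 2 + 2 * n * k = ((j : ℤ) - n).natAbs ^ 2 + 3 * n ^ 2 := by
  zify
  rw [sq_abs]
  have : (k : ℤ) = 2 * n - j := by omega
  rw [this]; ring

/-- The finite form of the Jacobi triple product. -/
lemma finite_triple_product (w : R⟦X⟧) (n : ℕ) :
    ∏ l ∈ range n, ((1 + w * X ^ (2 * l + 1)) * (w + X ^ (2 * l + 1))) =
      ∑ p ∈ antidiagonal (2 * n), qBinom (X ^ 2 : R⟦X⟧) (2 * n) p.1 * w ^ p.1 *
        X ^ (((p.1 : ℤ) - n).natAbs ^ 2) := by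
  have hodd : ∏ i ∈ range n, (X : R⟦X⟧) ^ (2 * i + 1) = X ^ (n ^ 2) := by
    rw [prod_pow_eq_pow_sum]
    congr 1
    induction n with
    | zero => rfl
    | succ n ih => rw [sum_range_succ, ih]; ring
  -- With this choice the lower `n` factors yield `w + X^(2l+1)` and the upper `n` yield `1 + w
  -- X^(2l+1)`, up to a total factor `X^(3n^2)`, cancelled below.
  have h := prod_add_mul_pow_eq_sum_qBinom (X ^ 2 : R⟦X⟧) (X ^ (2 * n)) (w * X) (2 * n)
  have hlow : ∏ i ∈ range n, ((X : R⟦X⟧) ^ (2 * n) + w * X * (X ^ 2) ^ i) =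
      X ^ (n ^ 2) * ∏ l ∈ range n, (w + X ^ (2 * l + 1)) := by
    rw [← hodd, ← prod_range_reflect (fun l ↦ w + (X : R⟦X⟧) ^ (2 * l + 1)), ← prod_mul_distrib]
    refine prod_congr rfl fun i hi ↦ ?_
    have hi' := mem_range.1 hi
    have e : 2 * n = (2 * i + 1) + (2 * (n - 1 - i) + 1) := by omega
    conv_lhs => rw [e]
    ring
  have hhigh : ∏ i ∈ range n, ((X : R⟦X⟧) ^ (2 * n) + w * X * (X ^ 2) ^ (n + i)) =
      X ^ (2 * n ^ 2) * ∏ l ∈ range n, (1 + w * X ^ (2 * l + 1)) := by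
    have : (X : R⟦X⟧) ^ (2 * n ^ 2) = ∏ i ∈ range n, X ^ (2 * n) := by
      rw [prod_const, card_range]; ring
    rw [this, ← prod_mul_distrib]
    refine prod_congr rfl fun i _ ↦ ?_
    ring
  have hsplit : range (2 * n) = range (n + n) := by rw [two_mul]
  rw [hsplit, prod_range_add, hlow, hhigh] at h
  have hreg : Function.Injective fun f : R⟦X⟧ ↦ X ^ (3 * n ^ 2) * f :=
    fun f g hfg ↦ PowerSeries.X_pow_mul_cancel hfg
  apply hreg
  simp only
  rw [prod_mul_distrib, mul_sum]
  calc _ = _ := by ring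
    _ = _ := h
    _ = _ := by
      refine sum_congr rfl fun p hp ↦ ?_
      have e := sq_add_eq_natAbs_sq_add (mem_antidiagonal.1 hp)
      calc _ = qBinom (X ^ 2 : R⟦X⟧) (2 * n) p.1 * w ^ p.1 *
            X ^ ((2 * p.1.choose 2 + p.1) + 2 * n * p.2) := by ring
        _ = _ := by rw [two_mul_choose_two_add, e]; ring

lemma X_pow_dvd_qPoch_sub {m j k : ℕ} (hj : m ≤ j) (hk : m ≤ k) :
    (X : R⟦X⟧) ^ (2 * m + 2) ∣ qPoch (X ^ 2) j - qPoch (X ^ 2) k := by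
  have aux : ∀ j, m ≤ j → (X : R⟦X⟧) ^ (2 * m + 2) ∣ qPoch (X ^ 2) j - qPoch (X ^ 2) m := by
    intro j hj
    induction j, hj using Nat.le_induction with
    | base => simp
    | succ j hj ih =>
      have h : (X : R⟦X⟧) ^ (2 * m + 2) ∣ (X ^ 2) ^ (j + 1) := by
        rw [← pow_mul]; exact pow_dvd_pow _ (by omega)
      have := dvd_sub ih (h.mul_left (qPoch (X ^ 2) j))
      rw [qPoch_succ]
      convert this using 1
      ring
  have := dvd_sub (aux j hj) (aux k hk)
  simpa using this

lemma isUnit_qPoch (j : ℕ) : IsUnit (qPoch (X ^ 2 : R⟦X⟧) j) := by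
  rw [PowerSeries.isUnit_iff_constantCoeff, qPoch, map_prod]
  simp

/-- After multiplication by the units `(q;q)_j (q;q)_k`, `q = X^2`, it suffices that Pochhammer
symbols of index at least `m` agree to this order. -/
lemma X_pow_dvd_qPoch_mul_qBinom_sub_one {m n j k : ℕ} (hj : m ≤ j) (hk : m ≤ k) (hn : m ≤ n) :
    (X : R⟦X⟧) ^ (2 * m + 2) ∣ qPoch (X ^ 2) n * qBinom (X ^ 2) (j + k) j - 1 := by
  have hu := (isUnit_qPoch (R := R) j).mul (isUnit_qPoch (R := R) k)
  rw [← hu.dvd_mul_left]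
  have h := qBinom_mul_qPoch (X ^ 2 : R⟦X⟧) j k
  have h1 := X_pow_dvd_qPoch_sub (R := R) (show m ≤ j + k by omega) hj
  have h2 := X_pow_dvd_qPoch_sub (R := R) hn hk
  have := dvd_add (h1.mul_left (qPoch (X ^ 2) n)) (h2.mul_left (qPoch (X ^ 2) j))
  convert this using 1
  rw [← h]
  ring

/-- The Jacobi triple product modulo a power of `X`. -/
lemma X_pow_dvd_triple_product_sub (w : R⟦X⟧) (n : ℕ) :
    X ^ (2 * n + 1) ∣
      qPoch (X ^ 2) n * ∏ l ∈ range n, ((1 + w * X ^ (2 * l + 1)) * (w + X ^ (2 * l + 1))) -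
      ∑ p ∈ antidiagonal (2 * n), w ^ p.1 * X ^ (((p.1 : ℤ) - n).natAbs ^ 2) := by
  rw [finite_triple_product, mul_sum, ← sum_sub_distrib]
  refine dvd_sum fun p hp ↦ ?_
  have hp' := mem_antidiagonal.1 hp
  have h := X_pow_dvd_qPoch_mul_qBinom_sub_one (R := R) (m := min p.1 p.2) (n := n)
    (min_le_left p.1 p.2) (min_le_right p.1 p.2) (by omega)
  rw [hp'] at h
  -- With `d = |p.1 - n|` the minimum is `n - d`, and the claim becomes `(d - 1)^2 ≥ 0`.
  have hle : 2 * n + 1 ≤ (2 * min p.1 p.2 + 2) + ((p.1 : ℤ) - n).natAbs ^ 2 := by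
    obtain ⟨d, hd⟩ : ∃ d, d = ((p.1 : ℤ) - n).natAbs := ⟨_, rfl⟩
    have : n = min p.1 p.2 + d := by omega
    rw [← hd]
    nlinarith [sq_nonneg ((d : ℤ) - 1)]
  refine (pow_dvd_pow _ hle).trans ?_
  rw [pow_add]
  convert (mul_dvd_mul h (dvd_refl ((X : R⟦X⟧) ^ (((p.1 : ℤ) - n).natAbs ^ 2)))).mul_left (w ^ p.1)
    using 1
  ring

end TripleProduct

/-! ### Generating function of `PD 2` -/

section GeneratingFunction

open scoped PowerSeries.WithPiTopology

variable {R : Type*} [CommRing R]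

/-- The weight of `c` occurrences of the part `i` in a partition into odd parts with designated
summands. -/
def oddDesignatedWeight (R : Type*) [CommRing R] (i c : ℕ) : R := if 2 ∣ i then 0 else (c : R)

lemma cast_PD_two (n : ℕ) :
    (PD 2 n : R) = coeff n (Nat.Partition.genFun (oddDesignatedWeight R)) := by
  classical
  rw [Nat.Partition.coeff_genFun, PD, Fintype.card_sigma, Nat.cast_sum,
    ← Finset.sum_filter_add_sum_filter_not univ
      (fun μ : n.Partition ↦ ∀ i ∈ μ.parts, ¬ 2 ∣ i)]
  rw [Finset.sum_eq_zero (s := filter (fun μ : n.Partition ↦ ¬ ∀ i ∈ μ.parts, ¬ 2 ∣ i) univ),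
    add_zero, Finset.sum_subtype (p := fun μ : n.Partition ↦ ∀ i ∈ μ.parts, ¬ 2 ∣ i) _ (by simp)]
  · refine Fintype.sum_congr _ _ fun μ ↦ ?_
    rw [Fintype.card_pi, Nat.cast_prod, Finsupp.prod, Multiset.toFinsupp_support]
    refine Eq.trans ?_ (Finset.prod_coe_sort μ.1.parts.toFinset _)
    refine Fintype.prod_congr _ _ fun i ↦ ?_
    simp [oddDesignatedWeight, μ.2 i.1 (Multiset.mem_toFinset.1 i.2)]
  · intro μ hμ
    simp only [mem_filter, mem_univ, true_and, not_forall, not_not] at hμ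
    obtain ⟨i, hi, h2⟩ := hμ
    rw [Finsupp.prod]
    exact Finset.prod_eq_zero (i := i) (by simpa using hi) (by simp [oddDesignatedWeight, h2])

variable [TopologicalSpace R] [DiscreteTopology R]

/-- The power series `∑ c X ^ (i c)` of the positive multiplicities of a part `i`, each counted
with its designations. -/
noncomputable def designatedSeries (R : Type*) [CommRing R] [TopologicalSpace R] (i : ℕ) : R⟦X⟧ :=
  ∑' j : ℕ, ((j + 1 : ℕ) : R) • X ^ (i * (j + 1))

lemma one_sub_X_pow_sq_mul_designatedSeries {i : ℕ} (hi : i ≠ 0) :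
    (1 - X ^ i) ^ 2 * designatedSeries R i = X ^ i := by
  have hs := Nat.Partition.summable_genFun_term' (fun _ c ↦ (c : R)) hi
  have hg := Nat.Partition.summable_genFun_term' (fun _ _ ↦ (1 : R)) hi
  have hG := hg.tsum_eq_zero_add
  have hS := hs.tsum_eq_zero_add
  simp only [one_smul, zero_add, mul_one] at hg hG hS
  have e1 : ∀ j : ℕ, (X : R⟦X⟧) ^ (i * (j + 1 + 1)) = X ^ i * X ^ (i * (j + 1)) := fun j ↦ by ring
  have e2 : ∀ j : ℕ, ((j + 1 + 1 : ℕ) : R) • (X : R⟦X⟧) ^ (i * (j + 1 + 1)) =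
      X ^ i * (((j + 1 : ℕ) : R) • X ^ (i * (j + 1))) + X ^ i * X ^ (i * (j + 1)) := fun j ↦ by
    simp only [smul_eq_C_mul, map_natCast]
    push_cast
    ring
  simp only [e2] at hS
  simp only [e1] at hG
  rw [Summable.tsum_add (hs.mul_left _) (hg.mul_left _), hs.tsum_mul_left, hg.tsum_mul_left] at hS
  rw [hg.tsum_mul_left] at hG
  simp only [Nat.cast_one, one_smul] at hS
  unfold designatedSeries
  linear_combination (1 - X ^ i) * hS + X ^ i * hG

lemma X_pow_dvd_designatedSeries (i : ℕ) : X ^ i ∣ designatedSeries R i := by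
  rcases eq_or_ne i 0 with rfl | hi
  · simp
  have hu : IsUnit ((1 - X ^ i : R⟦X⟧) ^ 2) := by
    rw [PowerSeries.isUnit_iff_constantCoeff]
    simp [hi]
  rw [← hu.dvd_mul_left, one_sub_X_pow_sq_mul_designatedSeries hi]

lemma dvd_prod_one_add_sub_one {ι S : Type*} [CommRing S] (d : S) (s : Finset ι) (g : ι → S)
    (h : ∀ i ∈ s, d ∣ g i) : d ∣ ∏ i ∈ s, (1 + g i) - 1 := by
  classical
  induction s using Finset.induction_on with
  | empty => simp
  | insert a s ha ih =>
    rw [prod_insert ha]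
    have h1 := ih fun i hi ↦ h i (mem_insert_of_mem hi)
    have h2 := h a (mem_insert_self a s)
    have := dvd_add h1 (h2.mul_right (∏ i ∈ s, (1 + g i)))
    convert this using 1
    ring

lemma X_pow_dvd_genFun_sub (n : ℕ) :
    X ^ (2 * n + 1) ∣ Nat.Partition.genFun (oddDesignatedWeight R) -
      ∏ l ∈ range n, (1 + designatedSeries R (2 * l + 1)) := by
  set g : ℕ → R⟦X⟧ := fun i ↦
    ∑' j, oddDesignatedWeight R (i + 1) (j + 1) • X ^ ((i + 1) * (j + 1)) with hg
  have hodd : ∀ l, g (2 * l) = designatedSeries R (2 * l + 1) := fun l ↦ by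
    have : ¬ 2 ∣ 2 * l + 1 := by omega
    simp only [hg, designatedSeries, oddDesignatedWeight, if_neg this]
  have heven : ∀ l, g (2 * l + 1) = 0 := fun l ↦ by
    have : 2 ∣ 2 * l + 1 + 1 := by omega
    simp [hg, oddDesignatedWeight, this]
  have hdvd : ∀ i, X ^ (i + 1) ∣ g i := fun i ↦ by
    rcases Nat.even_or_odd' i with ⟨l, rfl | rfl⟩
    · rw [hodd]; exact X_pow_dvd_designatedSeries _
    · rw [heven]; exact dvd_zero _
  have hprod : ∏ i ∈ range (2 * n), (1 + g i) =
      ∏ l ∈ range n, (1 + designatedSeries R (2 * l + 1)) := by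
    induction n with
    | zero => rfl
    | succ n ih =>
      rw [show 2 * (n + 1) = 2 * n + 1 + 1 by ring, prod_range_succ, prod_range_succ, ih,
        prod_range_succ, hodd, heven, add_zero, mul_one]
  have hP := Nat.Partition.hasProd_genFun (oddDesignatedWeight R)
  rw [HasProd, PowerSeries.WithPiTopology.tendsto_iff_coeff_tendsto] at hP
  rw [PowerSeries.X_pow_dvd_iff]
  intro d hd
  have hd' := hP d
  rw [nhds_discrete, Filter.tendsto_pure] at hd'
  -- Coefficients live in a discrete space, so some finite partial product already has the exact
  -- `d`-th coefficient.
  obtain ⟨s, hs, hs'⟩ := (hd'.and (Filter.eventually_ge_atTop (range (2 * n)))).exists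
  have hsub : X ^ (2 * n + 1) ∣ ∏ i ∈ s, (1 + g i) - ∏ i ∈ range (2 * n), (1 + g i) := by
    rw [← Finset.prod_sdiff hs', ← sub_one_mul]
    refine Dvd.dvd.mul_right (dvd_prod_one_add_sub_one _ _ _ fun i hi ↦ ?_) _
    refine (pow_dvd_pow _ ?_).trans (hdvd i)
    simp only [mem_sdiff, mem_range, not_lt] at hi
    omega
  have := PowerSeries.X_pow_dvd_iff.1 hsub d hd
  rw [map_sub, sub_eq_zero] at this ⊢
  rw [← hs, ← hprod, ← this]

end GeneratingFunction

/-! ### Theta series modulo 8 -/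

section Theta

variable {R : Type*} [CommRing R]

lemma sum_range_eq_of_symm {S : Type*} [CommRing S] (h : ℕ → S) (n : ℕ)
    (hsymm : ∀ d < n, h (n - 1 - d) = h (n + (d + 1))) :
    ∑ j ∈ range (2 * n + 1), h j = h n + 2 * ∑ d ∈ range n, h (n + (d + 1)) := by
  have e : range (2 * n + 1) = range (n + (n + 1)) := by congr 1; ring
  rw [e, sum_range_add, ← sum_range_reflect, sum_range_succ',
    sum_congr rfl fun d hd ↦ hsymm d (mem_range.1 hd)]
  simp only [add_zero]
  ring

lemma alternating_sum_eq {n : ℕ} (hn : Even n) :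
    ∑ p ∈ antidiagonal (2 * n), (-1 : R⟦X⟧) ^ p.1 * X ^ (((p.1 : ℤ) - n).natAbs ^ 2) =
      1 + 2 * ∑ d ∈ range n, (-1) ^ (d + 1) * X ^ ((d + 1) ^ 2) := by
  rw [Finset.Nat.sum_antidiagonal_eq_sum_range_succ_mk, sum_range_eq_of_symm]
  · have (d : ℕ) : (((n + (d + 1) : ℕ) : ℤ) - n).natAbs = d + 1 := by omega
    simp only [this]
    simp [pow_add, hn.neg_one_pow]
  · intro d hd
    have e1 : (((n - 1 - d : ℕ) : ℤ) - n).natAbs = d + 1 := by omega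
    have e2 : (((n + (d + 1) : ℕ) : ℤ) - n).natAbs = d + 1 := by omega
    simp only [e1, e2]
    congr 1
    have : n + (d + 1) = (n - 1 - d) + 2 * (d + 1) := by omega
    rw [this, pow_add _ (n - 1 - d), pow_mul]
    simp

lemma exists_sum_sq_eq {ι S : Type*} [CommRing S] (s : Finset ι) (g : ι → S) :
    ∃ r, (∑ i ∈ s, g i) ^ 2 = ∑ i ∈ s, g i ^ 2 + 2 * r := by
  classical
  induction s using Finset.induction_on with
  | empty => exact ⟨0, by simp⟩
  | insert a s ha ih =>
    obtain ⟨r, hr⟩ := ih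
    refine ⟨r + g a * ∑ i ∈ s, g i, ?_⟩
    rw [sum_insert ha, sum_insert ha]
    linear_combination hr

lemma coeff_theta_mul_eq_zero {ι κ : Type*} {N : ℕ} (h1 : ∀ a b : ℕ, a ^ 2 + b ^ 2 ≠ N)
    (h2 : ∀ a b : ℕ, a ^ 2 + 2 * b ^ 2 ≠ N) (s : Finset ι) (t : Finset κ) (c : ι → R) (d : κ → R)
    (a : ι → ℕ) (b : κ → ℕ) (u v : R) :
    coeff N ((∑ i ∈ s, C (c i) * X ^ (a i ^ 2)) *
      (1 + C u * ∑ k ∈ t, C (d k) * X ^ (b k ^ 2) + C v * ∑ k ∈ t, X ^ (2 * b k ^ 2))) = 0 := by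
  rw [sum_mul, map_sum]
  refine sum_eq_zero fun i _ ↦ ?_
  rw [mul_assoc, coeff_C_mul, mul_add, mul_add, mul_one, map_add, map_add, mul_left_comm,
    coeff_C_mul, mul_left_comm _ (C v), coeff_C_mul, mul_sum, mul_sum, map_sum, map_sum,
    coeff_X_pow, if_neg (by simpa using (h1 (a i) 0).symm)]
  rw [sum_eq_zero fun k _ ↦ ?_, sum_eq_zero fun k _ ↦ ?_]
  · simp
  · rw [← pow_add, coeff_X_pow, if_neg (h2 _ _).symm]
  · rw [mul_left_comm, coeff_C_mul, ← pow_add, coeff_X_pow, if_neg (h1 _ _).symm, mul_zero]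

/-- In a ring of characteristic dividing `8` with a root of `w ^ 2 + w + 1`, the number of
partitions of `N` into odd parts with designated summands vanishes unless `N` is represented by
`a ^ 2 + b ^ 2` or `a ^ 2 + 2 * b ^ 2`. -/
lemma cast_PD_two_eq_zero (h8 : (8 : R) = 0) {w : R} (hw : w ^ 2 + w + 1 = 0) {N : ℕ}
    (h1 : ∀ a b : ℕ, a ^ 2 + b ^ 2 ≠ N) (h2 : ∀ a b : ℕ, a ^ 2 + 2 * b ^ 2 ≠ N) :
    (PD 2 N : R) = 0 := by
  let _ : TopologicalSpace R := ⊥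
  have : DiscreteTopology R := ⟨rfl⟩
  rw [cast_PD_two]
  set P := Nat.Partition.genFun (oddDesignatedWeight R)
  -- Divisibility by 6 makes both `w^n` and `(-1)^n` equal to 1; size makes the truncation order `2n
  -- + 1` exceed `N`.
  set n := 6 * N with hn
  have hneven : Even n := ⟨3 * N, by omega⟩
  have hw3 : w ^ 3 = 1 := by linear_combination (w - 1) * hw
  have hwn : (C w : R⟦X⟧) ^ n = 1 := by
    rw [← map_pow, hn, show 6 * N = 3 * (2 * N) by ring, pow_mul, hw3, one_pow, map_one]
  have hW : (C w : R⟦X⟧) ^ 2 + C w + 1 = 0 := by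
    have := congrArg (C : R → R⟦X⟧) hw
    simpa using this
  have h8' : (8 : R⟦X⟧) = 0 := by
    rw [← map_ofNat (C : R →+* R⟦X⟧) 8, h8, map_zero]
  set T := ∏ l ∈ range n, (1 + designatedSeries R (2 * l + 1)) with hT
  set A := ∏ l ∈ range n, ((1 + C w * X ^ (2 * l + 1)) * (C w + X ^ (2 * l + 1)) : R⟦X⟧) with hA
  set B := ∏ l ∈ range n, ((1 + (-1) * X ^ (2 * l + 1)) * ((-1) + X ^ (2 * l + 1)) : R⟦X⟧) with hB
  have hBT : B * T = A := by
    have hA' : A = ∏ l ∈ range n, (1 - X ^ (2 * l + 1) + (X ^ (2 * l + 1)) ^ 2 : R⟦X⟧) := by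
      have hc : ∏ _l ∈ range n, (C w : R⟦X⟧) = 1 := by rw [prod_const, card_range, hwn]
      rw [hA, prod_congr rfl fun l _ ↦ show _ =
          C w * (1 - X ^ (2 * l + 1) + (X ^ (2 * l + 1)) ^ 2 : R⟦X⟧) by
        linear_combination X ^ (2 * l + 1) * hW, prod_mul_distrib, hc, one_mul]
    have hB' : B = ∏ l ∈ range n, ((1 - X ^ (2 * l + 1)) ^ 2 : R⟦X⟧) := by
      have hc : ∏ _l ∈ range n, (-1 : R⟦X⟧) = 1 := by
        rw [prod_const, card_range, hneven.neg_one_pow]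
      rw [hB, prod_congr rfl fun l _ ↦ show _ = (-1) * ((1 - X ^ (2 * l + 1)) ^ 2 : R⟦X⟧) by
        ring, prod_mul_distrib, hc, one_mul]
    rw [hA', hB', hT, ← prod_mul_distrib]
    refine prod_congr rfl fun l _ ↦ ?_
    have := one_sub_X_pow_sq_mul_designatedSeries (R := R) (i := 2 * l + 1) (by omega)
    linear_combination this
  have hPT : X ^ (2 * n + 1) ∣ P - T := X_pow_dvd_genFun_sub n
  have hC := X_pow_dvd_triple_product_sub (C w : R⟦X⟧) n
  have hΦ := X_pow_dvd_triple_product_sub (-1 : R⟦X⟧) n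
  rw [← hA] at hC
  rw [← hB, alternating_sum_eq hneven] at hΦ
  set Q := qPoch (X ^ 2 : R⟦X⟧) n
  set Θ := ∑ p ∈ antidiagonal (2 * n), (C w : R⟦X⟧) ^ p.1 * X ^ (((p.1 : ℤ) - n).natAbs ^ 2) with hΘ
  set t : R⟦X⟧ := ∑ d ∈ range n, (-1) ^ (d + 1) * X ^ ((d + 1) ^ 2) with ht
  obtain ⟨r, hr⟩ := exists_sum_sq_eq (range n) fun d ↦ (-1 : R⟦X⟧) ^ (d + 1) * X ^ ((d + 1) ^ 2)
  have hsq : ∑ d ∈ range n, ((-1 : R⟦X⟧) ^ (d + 1) * X ^ ((d + 1) ^ 2)) ^ 2 =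
      ∑ d ∈ range n, X ^ (2 * (d + 1) ^ 2) := by
    refine sum_congr rfl fun d _ ↦ ?_
    rw [mul_pow, ← pow_mul, mul_comm (d + 1) 2, pow_mul, neg_one_sq, one_pow, one_mul, ← pow_mul,
      mul_comm]
  rw [hsq, ← ht] at hr
  set u : R⟦X⟧ := ∑ d ∈ range n, X ^ (2 * (d + 1) ^ 2) with hu
  have hmain : X ^ (2 * n + 1) ∣ P - Θ * (1 + 6 * t + 4 * u) := by
    -- Here `P ≈ T`, `Q B ≈ 1 + 2t`, `Q A ≈ Θ` and `A = B T`, combined through `(1 + 2t)^4 = 1`.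
    have e : P - Θ * (1 + 6 * t + 4 * u) = (1 + 2 * t) ^ 4 * (P - T)
        - (1 + 2 * t) ^ 3 * T * (Q * B - (1 + 2 * t)) + (1 + 2 * t) ^ 3 * (Q * A - Θ) := by
      rw [← hBT]
      linear_combination (-(P * (t + 3 * t ^ 2 + 4 * t ^ 3 + 2 * t ^ 4)) + Θ * (u + t ^ 3 + 3 * r))
        * h8' + 12 * Θ * hr
    rw [e]
    exact dvd_add (dvd_sub (hPT.mul_left _) (hΦ.mul_left _)) (hC.mul_left _)
  have hcoeff := PowerSeries.X_pow_dvd_iff.1 hmain N (by omega)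
  rw [map_sub, sub_eq_zero] at hcoeff
  rw [hcoeff]
  have := coeff_theta_mul_eq_zero (R := R) h1 h2 (antidiagonal (2 * n)) (range n)
    (fun p ↦ w ^ p.1) (fun d ↦ (-1) ^ (d + 1)) (fun p ↦ ((p.1 : ℤ) - n).natAbs) (fun d ↦ d + 1) 6 4
  have h6 : (C 6 : R⟦X⟧) = 6 := map_ofNat _ 6
  have h4 : (C 4 : R⟦X⟧) = 4 := map_ofNat _ 4
  simpa [hΘ, ht, hu, h6, h4] using this

end Theta

/-! ### Numbers not represented by the two forms -/

section Arithmetic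

/-- Descent: halving `a^2 + b^2` with `a + b = 2x` gives `x^2 + (a - x)^2`; the base case is a
congruence obstruction. -/
lemma sq_add_sq_ne (α n : ℕ) (a b : ℤ) : a ^ 2 + b ^ 2 ≠ 2 ^ α * (8 * n + 7) := by
  induction α generalizing a b with
  | zero =>
    intro h
    rcases Int.even_or_odd' a with ⟨x, rfl | rfl⟩ <;> rcases Int.even_or_odd' b with ⟨y, rfl | rfl⟩ <;>
    · ring_nf at h; omega
  | succ α ih =>
    intro h
    rw [pow_succ 2 α] at h
    rcases Int.even_or_odd' (a + b) with ⟨x, hx | hx⟩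
    · obtain rfl : b = 2 * x - a := by omega
      apply ih x (a - x)
      linarith
    · obtain rfl : b = 2 * x + 1 - a := by omega
      have : 2 * (2 ^ α * (8 * (n : ℤ) + 7) - a ^ 2 - 2 * x ^ 2 - 2 * x + 2 * x * a + a) = 1 := by
        linarith
      omega

/-- Descent: for `a = 2x`, halving swaps the roles and gives `b^2 + 2x^2`. The base case is an
obstruction mod 8, using that `x(x+1)` is even. -/
lemma sq_add_two_mul_sq_ne (α n : ℕ) (a b : ℤ) : a ^ 2 + 2 * b ^ 2 ≠ 2 ^ α * (8 * n + 7) := by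
  induction α generalizing a b with
  | zero =>
    intro h
    rcases Int.even_or_odd' a with ⟨x, rfl | rfl⟩
    · ring_nf at h; omega
    · have hx := Int.even_mul_succ_self x
      obtain ⟨z, hz⟩ := hx
      rcases Int.even_or_odd' b with ⟨y, rfl | rfl⟩
      · ring_nf at h hz; omega
      · have hy := Int.even_mul_succ_self y
        obtain ⟨v, hv⟩ := hy
        ring_nf at h hz hv; omega
  | succ α ih =>
    intro h
    rw [pow_succ 2 α] at h
    rcases Int.even_or_odd' a with ⟨x, rfl | rfl⟩
    · apply ih b x
      linarith
    · have : 2 * (2 ^ α * (8 * (n : ℤ) + 7) - b ^ 2 - 2 * x ^ 2 - 2 * x) = 1 := by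
        linarith
      omega

end Arithmetic

theorem theorem2 (α n : ℕ) : PD 2 (2 ^ α * (8 * n + 7)) ≡ 0 [MOD 8] := by
  -- This is `(ZMod 8)[w]` with `w^2 = -1 - w`, free over `ZMod 8`, so vanishing there descends to
  -- `ZMod 8` by the `re` coordinate.
  have h8 : (8 : QuadraticAlgebra (ZMod 8) (-1) (-1)) = 0 := by
    ext <;> rfl
  have hw : (⟨0, 1⟩ : QuadraticAlgebra (ZMod 8) (-1) (-1)) ^ 2 + ⟨0, 1⟩ + 1 = 0 := by
    ext <;> rfl
  have h := cast_PD_two_eq_zero h8 hw (N := 2 ^ α * (8 * n + 7))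
    (fun a b h ↦ sq_add_sq_ne α n a b (by exact_mod_cast h))
    (fun a b h ↦ sq_add_two_mul_sq_ne α n a b (by exact_mod_cast h))
  rw [← ZMod.natCast_eq_natCast_iff]
  simpa using congrArg QuadraticAlgebra.re h
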